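/- Let $k\ge 1$ and let $c_1,\dots,c_k$ be positive integers. Then there is a vertex-transitive map $\mathcal M$, on a compact orientable surface without boundary, such that the reflections of $\mathcal M$ form exactly $k$ distinct conjugacy classes of the group $\mathrm{Aut}\,\mathcal M$, of sizes $c_1,\dots,c_k$. Moreover, $\mathcal M$ can be taken without free edges. Here a (connected) map $\mathcal M$ is given by its non-empty set $\Phi$ of flags (the triangles of the barycentric subdivision of $\mathcal M$, each with a vertex, an edge midpoint and a face centre as corners $0,1,2$) together with permutations $r_0,r_1,r_2$ of $\Phi$ which satisfy $r_i^2=(r_0r_2)^2=1$ and generate a transitive group; $r_i$ sends a flag to the other flag which shares the side opposite to corner $i$, or fixes the flag if that side lies on the boundary of the surface. The vertices of $\mathcal M$ are the orbits of $\langle r_1,r_2\rangle$ on $\Phi$. The surface is compact if $\Phi$ is finite, it is without boundary if no $r_i$ fixes a flag, and it is orientable if one can assign signs to the flags so that $\phi$ and $r_i\phi$ have opposite signs whenever $r_i\phi\ne\phi$; $\mathcal M$ has no free edges (edges with an end that is not a vertex) if $r_0r_2$ fixes no flag. The group $\mathrm{Aut}\,\mathcal M$ is the centraliser of $\langle r_0,r_1,r_2\rangle$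 in $\mathrm{Sym}\,\Phi$, and $\mathcal M$ is vertex-transitive if this group acts transitively on the vertices. A reflection of $\mathcal M$ is a non-identity automorphism $a$ for which $a\phi=r_i\phi$ for some flag $\phi$ and some $i\in\{0,1,2\}$ (so that $a$ fixes a side of a triangle pointwise and acts as a reflection near an interior point of it). -/

import Mathlib

/-- A connected map on a surface (possibly non-orientable, non-compact or with boundary), given by
its flags. `Φ` is the set of flags, that is, of the triangles of the barycentric subdivision of
the map; the corners of a triangle are a vertex (`0`), an edge midpoint (`1`) and a face
centre (`2`). The permutation `r i` sends a flag to the other flag (if any) which shares with it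
the side opposite to corner `i`, and fixes the flag if that side lies on the boundary.
Connectedness says that `r 0`, `r 1`, `r 2` generate a group transitive on the (non-empty) set of
flags. -/
structure SurfaceMap (Φ : Type*) where
  r : Fin 3 → Equiv.Perm Φ
  r_sq : ∀ i, r i ^ 2 = 1
  r_zero_two_sq : (r 0 * r 2) ^ 2 = 1
  nonempty : Nonempty Φ
  connected : ∀ φ ψ : Φ, ∃ g ∈ Subgroup.closure (Set.range r), g φ = ψ

namespace SurfaceMap

variable {Φ : Type*} (M : SurfaceMap Φ)

/-- The monodromy group `⟨r 0, r 1, r 2⟩`. -/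
def Mon : Subgroup (Equiv.Perm Φ) := Subgroup.closure (Set.range M.r)

/-- The automorphism group of the map: the centraliser of the monodromy group in the symmetric
group on the flags. -/
def Aut : Subgroup (Equiv.Perm Φ) := Subgroup.centralizer (M.Mon : Set (Equiv.Perm Φ))

/-- The flags at the vertex of the flag `φ`: the orbit of `φ` under `⟨r 1, r 2⟩`. -/
def vertexOf (φ : Φ) : Set Φ :=
  {ψ | ∃ g ∈ Subgroup.closure {M.r 1, M.r 2}, g φ = ψ}

/-- The vertices of the map, each identified with its set of flags. -/
def vertices : Set (Set Φ) := Set.range M.vertexOf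

/-- The automorphism group acts transitively on the vertices. -/
def VertexTransitive : Prop :=
  ∀ v ∈ M.vertices, ∀ w ∈ M.vertices, ∃ a ∈ M.Aut, a '' v = w

/-- The surface carrying the map has empty boundary: every side of every flag is shared with
another flag. -/
def WithoutBoundary : Prop := ∀ i φ, M.r i φ ≠ φ

/-- Every edge is a genuine edge (a loop, or an edge joining two vertices), not a free edge
ending at a point which is not a vertex: the half-turn `r 0 * r 2` about the midpoint of an edge
moves each flag at this edge. -/
def WithoutFreeEdges : Prop := ∀ φ, (M.r 0 * M.r 2) φ ≠ φ

/-- The surface carrying the map is orientable: the triangles of the barycentric subdivision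
can be given orientations (signs) such that any two different triangles with a common side have
opposite signs. -/
def Orientable : Prop := ∃ s : Φ → Bool, ∀ i φ, M.r i φ ≠ φ → s (M.r i φ) ≠ s φ

/-- The surface carrying the map is compact: it is made of finitely many triangles. -/
def IsCompactMap (_M : SurfaceMap Φ) : Prop := Finite Φ

/-- An automorphism is a reflection if it is not the identity and transposes some flag with a
neighbouring flag `r i φ`. It then fixes the points of the side common to both triangles, and it
acts as a reflection on a disc around any interior point of this side. -/
def IsReflection (a : M.Aut) : Prop :=
  a ≠ 1 ∧ ∃ (i : Fin 3) (φ : Φ), (a : Equiv.Perm Φ) φ = M.r i φ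

end SurfaceMap

/-! Let `G` be the product of the dihedral groups of order `4 * c j`. Each factor is generated by
the reflections `sr 0` and `sr 1`, and the class of `sr 0` has exactly `c j` elements. A sign `ε` on
`G` takes the value `-1` on each `sr 0` and `1` on each `sr 1`. List these involutions, with
repetitions, in a cyclic order `x`, and form the Cayley map in which the local rotation at `g` runs
in the sense `ε g`. Then `G` acts by left translations, regularly on the vertices, and `h` reverses
orientation exactly when `ε h = -1`. A translation takes a flag to a neighbour only across the
middle of an edge, which happens exactly for conjugates of those `x i` with `ε (x i) = -1`
(`isReflection_cayleyAutEquiv_iff`). These form one class per factor, of size `c j`. There must be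
no further automorphisms: the repetitions in `x` produce parallel edges whose pattern every
automorphism has to respect (`exists_leftTranslation_eq`). -/

namespace SurfaceMap

/-! ### Cayley maps with signed edges, their automorphisms and reflections. -/

section CayleyMap

variable {d : ℕ} {G : Type}

/-- The flags of a Cayley map: a dart label, a side of the dart, and a vertex. -/
abbrev CayleyFlag (d : ℕ) (G : Type) : Type := ZMod d × ℤˣ × G

/-- The passage to the other side of the corner between two consecutive darts. -/
def cayleyCorner (d : ℕ) (G : Type) : Equiv.Perm (CayleyFlag d G) :=
  Function.Involutive.toPerm (fun φ => (φ.1 + ((φ.2.1 : ℤ) : ZMod d), -φ.2.1, φ.2.2)) (by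
    rintro ⟨i, s, g⟩
    simp)

/-- The passage to the other side of a dart. -/
def cayleySide (d : ℕ) (G : Type) : Equiv.Perm (CayleyFlag d G) :=
  Function.Involutive.toPerm (fun φ => (φ.1, -φ.2.1, φ.2.2)) (by
    rintro ⟨i, s, g⟩
    simp)

@[simp] lemma cayleyCorner_apply (i : ZMod d) (s : ℤˣ) (g : G) :
    cayleyCorner d G (i, s, g) = (i + ((s : ℤ) : ZMod d), -s, g) := rfl

@[simp] lemma cayleySide_apply (i : ZMod d) (s : ℤˣ) (g : G) :
    cayleySide d G (i, s, g) = (i, -s, g) := rfl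

lemma exists_rotate_apply_eq [NeZero d] (i j : ZMod d) (s s' : ℤˣ) (g : G) :
    ∃ p ∈ Subgroup.closure {cayleyCorner d G, cayleySide d G}, p (i, s, g) = (j, s', g) := by
  set H := Subgroup.closure {cayleyCorner d G, cayleySide d G}
  have h1 : cayleyCorner d G ∈ H := Subgroup.subset_closure (by simp)
  have h2 : cayleySide d G ∈ H := Subgroup.subset_closure (by simp)
  have flip : ∀ (i : ZMod d) (s s' : ℤˣ), ∃ p ∈ H, p (i, s, g) = (i, s', g) := by
    intro i s s'
    rcases Int.units_eq_one_or s with rfl | rfl <;> rcases Int.units_eq_one_or s' with rfl | rfl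
    · exact ⟨1, H.one_mem, rfl⟩
    · exact ⟨_, h2, rfl⟩
    · exact ⟨_, h2, by simp⟩
    · exact ⟨1, H.one_mem, rfl⟩
  have shift : ∀ n : ℕ, ∃ p ∈ H, p (i, 1, g) = (i + n, 1, g) := by
    intro n
    induction n with
    | zero => exact ⟨1, H.one_mem, by simp⟩
    | succ n ih =>
      obtain ⟨p, hp, h⟩ := ih
      refine ⟨cayleySide d G * cayleyCorner d G * p, H.mul_mem (H.mul_mem h2 h1) hp, ?_⟩
      simp [Equiv.Perm.mul_apply, h, add_assoc]
  obtain ⟨p, hp, h⟩ := flip i s 1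
  obtain ⟨q, hq, h'⟩ := shift (j - i).val
  obtain ⟨t, ht, h''⟩ := flip j 1 s'
  refine ⟨t * q * p, H.mul_mem (H.mul_mem ht hq) hp, ?_⟩
  rw [ZMod.natCast_zmod_val, add_sub_cancel] at h'
  rw [Equiv.Perm.mul_apply, Equiv.Perm.mul_apply, h, h', h'']

variable [Group G] (x : ZMod d → G) (hx : ∀ i, x i * x i = 1) (ε : G →* ℤˣ)

/-- The reversal of the edges of a Cayley map: the dart labelled `i` at `g` leads to `g * x i`, and
the local orientation is preserved according to `ε (x i)`. -/
def cayleyEdge : Equiv.Perm (CayleyFlag d G) :=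
  Function.Involutive.toPerm (fun φ => (φ.1, -(ε (x φ.1)) * φ.2.1, φ.2.2 * x φ.1)) (by
    rintro ⟨i, s, g⟩
    simp [mul_assoc, hx, ← mul_assoc (ε (x i))])

@[simp] lemma cayleyEdge_apply (i : ZMod d) (s : ℤˣ) (g : G) :
    cayleyEdge x hx ε (i, s, g) = (i, -(ε (x i)) * s, g * x i) := rfl

lemma exists_cayley_apply_eq [NeZero d] (hgen : Subgroup.closure (Set.range x) = ⊤)
    (φ ψ : CayleyFlag d G) :
    ∃ p ∈ Subgroup.closure (Set.range ![cayleyEdge x hx ε, cayleyCorner d G, cayleySide d G]),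
      p φ = ψ := by
  set M := Subgroup.closure (Set.range ![cayleyEdge x hx ε, cayleyCorner d G, cayleySide d G])
    with hM
  have h0 : cayleyEdge x hx ε ∈ M := Subgroup.subset_closure ⟨0, rfl⟩
  have hle : Subgroup.closure {cayleyCorner d G, cayleySide d G} ≤ M := by
    rw [Subgroup.closure_le]
    rintro p (rfl | rfl)
    · exact Subgroup.subset_closure ⟨1, rfl⟩
    · exact Subgroup.subset_closure ⟨2, rfl⟩
  have rot : ∀ (i j : ZMod d) (s s' : ℤˣ) (g : G), ∃ p ∈ M, p (i, s, g) = (j, s', g) := by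
    intro i j s s' g
    obtain ⟨p, hp, h⟩ := exists_rotate_apply_eq i j s s' g
    exact ⟨p, hle hp, h⟩
  have trans : ∀ h : G, ∀ g : G, ∃ p ∈ M, p ((0, 1, g) : CayleyFlag d G) = (0, 1, g * h) := by
    intro h
    have hh : h ∈ Subgroup.closure (Set.range x) := hgen ▸ Subgroup.mem_top h
    induction hh using Subgroup.closure_induction with
    | mem y hy =>
      obtain ⟨i, rfl⟩ := hy
      intro g
      obtain ⟨p, hp, h⟩ := rot 0 i 1 1 g
      obtain ⟨q, hq, h'⟩ := rot i 0 (-(ε (x i)) * 1) 1 (g * x i)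
      refine ⟨q * cayleyEdge x hx ε * p, M.mul_mem (M.mul_mem hq h0) hp, ?_⟩
      rw [Equiv.Perm.mul_apply, Equiv.Perm.mul_apply, h, cayleyEdge_apply, h']
    | one => exact fun g => ⟨1, M.one_mem, by simp⟩
    | mul y z _ _ hy hz =>
      intro g
      obtain ⟨p, hp, h⟩ := hy g
      obtain ⟨q, hq, h'⟩ := hz (g * y)
      exact ⟨q * p, M.mul_mem hq hp, by rw [Equiv.Perm.mul_apply, h, h', mul_assoc]⟩
    | inv y _ hy =>
      intro g
      obtain ⟨p, hp, h⟩ := hy (g * y⁻¹)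
      refine ⟨p⁻¹, M.inv_mem hp, ?_⟩
      rw [Equiv.Perm.inv_eq_iff_eq, h, inv_mul_cancel_right]
  obtain ⟨i, s, g⟩ := φ
  obtain ⟨j, s', g'⟩ := ψ
  obtain ⟨p, hp, h⟩ := rot i 0 s 1 g
  obtain ⟨q, hq, h'⟩ := trans (g⁻¹ * g') g
  obtain ⟨t, ht, h''⟩ := rot 0 j 1 s' g'
  refine ⟨t * q * p, M.mul_mem (M.mul_mem ht hq) hp, ?_⟩
  rw [mul_inv_cancel_left] at h'
  rw [Equiv.Perm.mul_apply, Equiv.Perm.mul_apply, h, h', h'']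

/-- The Cayley map of a group generated by the cyclic sequence `x` of involutions. -/
def cayleyMap [NeZero d] (hgen : Subgroup.closure (Set.range x) = ⊤) :
    SurfaceMap (CayleyFlag d G) where
  r := ![cayleyEdge x hx ε, cayleyCorner d G, cayleySide d G]
  r_sq := by
    intro i
    ext1 φ
    fin_cases i
    · exact (cayleyEdge x hx ε).eq_symm_apply.1 rfl
    · exact (cayleyCorner d G).eq_symm_apply.1 rfl
    · exact (cayleySide d G).eq_symm_apply.1 rfl
  r_zero_two_sq := by
    ext1 ⟨i, s, g⟩
    simp [pow_two, Equiv.Perm.mul_apply, mul_assoc, hx, ← mul_assoc (ε (x i))]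
  nonempty := ⟨(0, 1, 1)⟩
  connected := exists_cayley_apply_eq x hx ε hgen

/-- The left translations, acting as automorphisms of a Cayley map. -/
def leftTranslation (d : ℕ) (G : Type) [Group G] : G →* Equiv.Perm (CayleyFlag d G) where
  toFun h :=
    { toFun := fun φ => (φ.1, φ.2.1, h * φ.2.2)
      invFun := fun φ => (φ.1, φ.2.1, h⁻¹ * φ.2.2)
      left_inv := fun φ => by simp
      right_inv := fun φ => by simp }
  map_one' := by ext1 φ; simp
  map_mul' a b := by ext1 φ; simp [mul_assoc]

@[simp] lemma leftTranslation_apply (h : G) (i : ZMod d) (s : ℤˣ) (g : G) :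
    leftTranslation d G h (i, s, g) = (i, s, h * g) := rfl

lemma mem_aut_iff {Φ : Type*} (M : SurfaceMap Φ) (a : Equiv.Perm Φ) :
    a ∈ M.Aut ↔ ∀ i φ, a (M.r i φ) = M.r i (a φ) := by
  rw [Aut, Mon, Subgroup.centralizer_closure, Subgroup.mem_centralizer_iff]
  simp only [Set.forall_mem_range, Equiv.ext_iff, Equiv.Perm.mul_apply]
  exact ⟨fun h i φ => (h i φ).symm, fun h i φ => (h i φ).symm⟩

/-- The centraliser of a transitive group acts semiregularly. -/
lemma aut_ext {Φ : Type*} (M : SurfaceMap Φ) {a b : Equiv.Perm Φ} (ha : a ∈ M.Aut)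
    (hb : b ∈ M.Aut) {φ : Φ} (h : a φ = b φ) : a = b := by
  ext1 ψ
  obtain ⟨p, hp, rfl⟩ := M.connected φ ψ
  have h1 := DFunLike.congr_fun (Subgroup.mem_centralizer_iff.1 ha p hp) φ
  have h2 := DFunLike.congr_fun (Subgroup.mem_centralizer_iff.1 hb p hp) φ
  rw [Equiv.Perm.mul_apply, Equiv.Perm.mul_apply] at h1 h2
  rw [← h1, ← h2, h]

variable [NeZero d] (hgen : Subgroup.closure (Set.range x) = ⊤)

lemma leftTranslation_mem_aut (h : G) : leftTranslation d G h ∈ (cayleyMap x hx ε hgen).Aut := by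
  rw [mem_aut_iff]
  rintro i ⟨j, s, g⟩
  fin_cases i <;> simp [cayleyMap, mul_assoc]

lemma vertexOf_cayleyMap (φ : CayleyFlag d G) :
    (cayleyMap x hx ε hgen).vertexOf φ = {ψ | ψ.2.2 = φ.2.2} := by
  obtain ⟨i, s, g⟩ := φ
  ext ⟨j, s', g'⟩
  constructor
  · rintro ⟨p, hp, h⟩
    have key : ∀ φ : CayleyFlag d G, (p φ).2.2 = φ.2.2 := by
      clear h
      induction hp using Subgroup.closure_induction with
      | mem y hy => rcases hy with rfl | rfl <;> exact fun φ => rfl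
      | one => exact fun φ => rfl
      | mul y z _ _ hy hz => exact fun φ => (hy (z φ)).trans (hz φ)
      | inv y _ hy =>
        intro φ
        have := hy (y⁻¹ φ)
        rw [← Equiv.Perm.mul_apply, mul_inv_cancel, Equiv.Perm.one_apply] at this
        exact this.symm
    have := key (i, s, g)
    rw [h] at this
    exact this
  · intro h
    obtain rfl : g' = g := h
    exact exists_rotate_apply_eq i j s s' g'

lemma cayleyMap_vertexTransitive : (cayleyMap x hx ε hgen).VertexTransitive := by
  rintro _ ⟨φ, rfl⟩ _ ⟨ψ, rfl⟩
  refine ⟨_, leftTranslation_mem_aut x hx ε hgen (ψ.2.2 * φ.2.2⁻¹), ?_⟩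
  rw [vertexOf_cayleyMap, vertexOf_cayleyMap]
  ext ⟨i, s, g⟩
  constructor
  · rintro ⟨⟨j, s', g'⟩, h, h'⟩
    simp only [Set.mem_ofPred_eq] at h
    simp only [leftTranslation_apply, h, inv_mul_cancel_right, Prod.mk.injEq] at h'
    exact h'.2.2.symm
  · intro h
    simp only [Set.mem_ofPred_eq] at h
    exact ⟨(i, s, φ.2.2), rfl, by rw [leftTranslation_apply, inv_mul_cancel_right, h]⟩

lemma cayleyMap_orientable : (cayleyMap x hx ε hgen).Orientable := by
  -- Labels at `g` increase in the sense `ε g`, so the side is corrected by this sign to give a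
  -- global orientation.
  refine ⟨fun φ => decide (φ.2.1 * ε φ.2.2 = 1), ?_⟩
  rintro i ⟨j, s, g⟩ -
  have key : ∀ a b : ℤˣ, b = -a → decide (b = 1) ≠ decide (a = 1) := by decide
  apply key
  fin_cases i
  · simp only [cayleyMap, Fin.zero_eta, Matrix.cons_val_zero, cayleyEdge_apply, map_mul]
    rcases Int.units_eq_one_or (ε (x j)) with h | h <;> simp [h]
  · simp [cayleyMap]
  · simp [cayleyMap]

lemma units_neg_ne (s : ℤˣ) : -s ≠ s := by
  rcases Int.units_eq_one_or s with rfl | rfl <;> decide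

lemma cayleyMap_withoutBoundary (hx1 : ∀ i, x i ≠ 1) :
    (cayleyMap x hx ε hgen).WithoutBoundary := by
  rintro i ⟨j, s, g⟩
  fin_cases i <;> simp [cayleyMap, hx1]

lemma cayleyMap_withoutFreeEdges (hx1 : ∀ i, x i ≠ 1) :
    (cayleyMap x hx ε hgen).WithoutFreeEdges := by
  rintro ⟨j, s, g⟩
  simp [cayleyMap, hx1]

/-- A cyclic sequence of involutions in which the pattern of repetitions singles out the place `0`
and the positive direction. -/
structure IsRigid : Prop where
  two_ne : (2 : ZMod d) ≠ 0
  zero_even : ε (x 0) = 1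
  one_eq : x 1 = x 0
  three_eq : x 3 = x 0
  neg_two_ne : x (-2) ≠ x 0
  eq_zero : ∀ i, ε (x i) = 1 → x (i + 1) = x i → i = 0

/-- The coincidences `x 1 = x 0` and `x 3 = x 0` say that certain monodromy words agree at the flag
`(0, 1, 1)`. An automorphism carries these relations to the image flag, and rigidity then forces its
label to be `0` and its side to be `1`; a left translation has the same effect on this flag. -/
lemma exists_leftTranslation_eq (hr : IsRigid x ε) {a : Equiv.Perm (CayleyFlag d G)}
    (ha : a ∈ (cayleyMap x hx ε hgen).Aut) : ∃ h, leftTranslation d G h = a := by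
  have comm := (mem_aut_iff _ _).1 ha
  have c0 : ∀ φ, a (cayleyEdge x hx ε φ) = cayleyEdge x hx ε (a φ) := comm 0
  have c1 : ∀ φ, a (cayleyCorner d G φ) = cayleyCorner d G (a φ) := comm 1
  have c2 : ∀ φ, a (cayleySide d G φ) = cayleySide d G (a φ) := comm 2
  -- `y` travels along a dart, and `p` turns to the next dart at the same vertex.
  set y : Equiv.Perm (CayleyFlag d G) := cayleyEdge x hx ε * cayleySide d G with hy
  set p : Equiv.Perm (CayleyFlag d G) := cayleySide d G * cayleyCorner d G with hp
  have cy : ∀ φ, a (y φ) = y (a φ) := fun φ => by simp only [hy, Equiv.Perm.mul_apply, c0, c2]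
  have cp : ∀ φ, a (p φ) = p (a φ) := fun φ => by simp only [hp, Equiv.Perm.mul_apply, c1, c2]
  have y_apply : ∀ i s g, y (i, s, g) = (i, ε (x i) * s, g * x i) := fun i s g => by
    simp [hy, Equiv.Perm.mul_apply]
  have p_apply : ∀ i s g, p (i, s, g) = (i + ((s : ℤ) : ZMod d), s, g) := fun i s g => by
    simp [hp, Equiv.Perm.mul_apply]
  have inj : ∀ i j, x i * x j = 1 → x j = x i := fun i j h => by
    rw [← mul_left_cancel_iff (a := x i), h, hx]
  have e1 : y (p (y (0, 1, 1))) = p (0, 1, 1) := by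
    simp [y_apply, p_apply, hr.zero_even, hr.one_eq, hx]
  have e3 : y (p (p (p (y (0, 1, 1))))) = p (p (p (0, 1, 1))) := by
    have : (1 : ZMod d) + 1 + 1 = 3 := by norm_num
    simp [y_apply, p_apply, hr.zero_even, hr.three_eq, hx, this]
  have f1 := congrArg a e1
  have f3 := congrArg a e3
  simp only [cy, cp] at f1 f3
  obtain ⟨⟨i, s, g⟩, hφ⟩ : ∃ φ, a (0, 1, 1) = φ := ⟨_, rfl⟩
  rw [hφ] at f1 f3
  simp only [y_apply, p_apply, Prod.mk.injEq, mul_assoc, mul_eq_left] at f1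
  obtain ⟨f1a, -, f1c⟩ := f1
  -- If the sense of rotation changed along the edge, the labels `i - s` and `i + s` would coincide,
  -- against `2 ≠ 0`.
  have hε : ε (x i) = 1 := by
    rcases Int.units_eq_one_or (ε (x i)) with h | h
    · exact h
    · exfalso
      rw [h] at f1a
      have h2 : (2 : ZMod d) * ((s : ℤ) : ZMod d) = 0 := by
        push_cast at f1a
        linear_combination -f1a
      apply hr.two_ne
      rcases Int.units_eq_one_or s with rfl | rfl <;> simpa using h2
  simp only [hε, one_mul, y_apply, p_apply, Prod.mk.injEq, mul_assoc, mul_eq_left] at f1c f3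
  have g1 := inj _ _ f1c
  have g3 := inj _ _ f3.2.2
  have hs : i = 0 ∧ s = 1 := by
    rcases Int.units_eq_one_or s with rfl | rfl
    · exact ⟨hr.eq_zero i hε (by simpa using g1), rfl⟩
    -- A mirror image would swap the places `0` and `1` of the repeated pair; the place `3` would
    -- then go to `-2`.
    · exfalso
      have hi : i - 1 = 0 := by
        have g1' : x (i - 1) = x i := by simpa [sub_eq_add_neg] using g1
        apply hr.eq_zero
        · rw [g1', hε]
        · rw [sub_add_cancel, g1']
      obtain rfl := sub_eq_zero.1 hi
      apply hr.neg_two_ne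
      rw [hr.one_eq] at g3
      rw [← g3]
      congr 1
      push_cast
      ring
  obtain ⟨rfl, rfl⟩ := hs
  refine ⟨g, aut_ext _ (leftTranslation_mem_aut x hx ε hgen g) ha (φ := (0, 1, 1)) ?_⟩
  rw [hφ, leftTranslation_apply, mul_one]

/-- The automorphism group of a rigid Cayley map is the underlying group. -/
noncomputable def cayleyAutEquiv (hr : IsRigid x ε) : G ≃* (cayleyMap x hx ε hgen).Aut :=
  MulEquiv.ofBijective
    ((leftTranslation d G).codRestrict _ (leftTranslation_mem_aut x hx ε hgen)) (by
      constructor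
      · intro a b hab
        have h := DFunLike.congr_fun (congrArg Subtype.val hab) ((0, 1, 1) : CayleyFlag d G)
        simpa using h
      · rintro ⟨a, ha⟩
        obtain ⟨h, rfl⟩ := exists_leftTranslation_eq x hx ε hgen hr ha
        exact ⟨h, rfl⟩)

lemma isReflection_cayleyAutEquiv_iff (hr : IsRigid x ε) (hx1 : ∀ i, x i ≠ 1) (h : G) :
    (cayleyMap x hx ε hgen).IsReflection (cayleyAutEquiv x hx ε hgen hr h) ↔
      ∃ i, ε (x i) = -1 ∧ IsConj (x i) h := by
  have coe : ((cayleyAutEquiv x hx ε hgen hr h : (cayleyMap x hx ε hgen).Aut) :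
      Equiv.Perm (CayleyFlag d G)) = leftTranslation d G h := rfl
  constructor
  · rintro ⟨-, i, ⟨j, s, g⟩, h'⟩
    rw [coe, leftTranslation_apply] at h'
    fin_cases i
    · simp only [cayleyMap, Fin.zero_eta, Matrix.cons_val_zero, cayleyEdge_apply,
        Prod.mk.injEq] at h'
      obtain ⟨-, h1, h2⟩ := h'
      refine ⟨j, ?_, isConj_iff.2 ⟨g, by rw [← h2, mul_inv_cancel_right]⟩⟩
      rw [right_eq_mul] at h1
      exact neg_eq_iff_eq_neg.1 h1
    · simp only [cayleyMap, Fin.mk_one, Matrix.cons_val_one, Matrix.cons_val_zero,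
        cayleyCorner_apply, Prod.mk.injEq] at h'
      -- Corners and sides of darts change the side `s`, which left translations preserve.
      exact absurd h'.2.1.symm (units_neg_ne s)
    · simp only [cayleyMap, Fin.reduceFinMk, Matrix.cons_val, cayleySide_apply,
        Prod.mk.injEq] at h'
      exact absurd h'.2.1.symm (units_neg_ne s)
  · rintro ⟨i, hi, hc⟩
    refine ⟨?_, 0, ?_⟩
    · intro h1
      rw [MulEquiv.map_eq_one_iff] at h1
      subst h1
      exact hx1 i (isConj_one_left.1 hc)
    · obtain ⟨g, rfl⟩ := isConj_iff.1 hc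
      refine ⟨(i, 1, g), ?_⟩
      rw [coe, leftTranslation_apply]
      simp [cayleyMap, hi]

end CayleyMap

end SurfaceMap

/-! ### Conjugacy in dihedral groups and in products. -/

lemma MulEquiv.isConj_map_iff {A B : Type*} [Group A] [Group B] (e : A ≃* B) {a b : A} :
    IsConj (e a) (e b) ↔ IsConj a b := by
  refine ⟨fun h => ?_, fun h => e.toMonoidHom.map_isConj h⟩
  have h' := e.symm.toMonoidHom.map_isConj h
  rwa [MulEquiv.toMonoidHom_eq_coe, MonoidHom.coe_coe, e.symm_apply_apply,
    e.symm_apply_apply] at h'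

lemma MulEquiv.carrier_conjClasses_mk {A B : Type*} [Group A] [Group B] (e : A ≃* B) (a : A) :
    (ConjClasses.mk (e a)).carrier = e '' {z | IsConj a z} := by
  ext b
  obtain ⟨z, rfl⟩ := e.surjective b
  rw [ConjClasses.mem_carrier_iff_mk_eq, ConjClasses.mk_eq_mk_iff_isConj,
    e.injective.mem_set_image, isConj_comm, e.isConj_map_iff]
  rfl

namespace DihedralGroup

lemma closure_sr_zero_sr_one (n : ℕ) :
    Subgroup.closure {(sr 0 : DihedralGroup n), sr 1} = ⊤ := by
  rw [eq_top_iff]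
  rintro y -
  set H := Subgroup.closure {(sr 0 : DihedralGroup n), sr 1}
  have h0 : (sr 0 : DihedralGroup n) ∈ H := Subgroup.subset_closure (by simp)
  have h1 : (sr 1 : DihedralGroup n) ∈ H := Subgroup.subset_closure (by simp)
  have hr : ∀ i : ZMod n, r i ∈ H := by
    intro i
    obtain ⟨m, rfl⟩ := ZMod.intCast_surjective i
    have := H.zpow_mem (H.mul_mem h0 h1) m
    simpa using this
  rcases y with i | i
  · exact hr i
  · simpa using H.mul_mem h0 (hr i)

/-- The sign `r i ↦ (-1) ^ i`, `sr i ↦ -(-1) ^ i` of a dihedral group with an even number of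
rotations. -/
def altSign (c : ℕ) : DihedralGroup (2 * c) →* ℤˣ :=
  let χ : ZMod (2 * c) → ℤˣ := fun i =>
    if ZMod.castHom (dvd_mul_right 2 c) (ZMod 2) i = 0 then 1 else -1
  have hadd : ∀ i j, χ (i + j) = χ i * χ j := fun i j => by
    have key : ∀ a b : ZMod 2, (if a + b = 0 then (1 : ℤˣ) else -1) =
        (if a = 0 then 1 else -1) * if b = 0 then 1 else -1 := by decide
    simp only [χ, map_add, key]
  have hsub : ∀ i j, χ (i - j) = χ i * χ j := fun i j => by
    have key : ∀ a b : ZMod 2, (if a - b = 0 then (1 : ℤˣ) else -1) =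
        (if a = 0 then 1 else -1) * if b = 0 then 1 else -1 := by decide
    simp only [χ, map_sub, key]
  { toFun := fun y => match y with
      | r i => χ i
      | sr i => -χ i
    map_one' := by
      change χ 0 = 1
      simp [χ]
    map_mul' := by
      rintro (i | i) (j | j)
      · exact hadd i j
      · change -χ (j - i) = χ i * -χ j
        rw [hsub, mul_neg, mul_comm]
      · change -χ (i + j) = -χ i * χ j
        rw [hadd, neg_mul]
      · change χ (j - i) = -χ i * -χ j
        rw [hsub, neg_mul_neg, mul_comm] }

lemma altSign_sr_zero (c : ℕ) : altSign c (sr 0) = -1 := by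
  simp [altSign]

lemma altSign_sr_one (c : ℕ) : altSign c (sr 1) = 1 := by
  simp [altSign]

/-- Conjugation shifts the index of a reflection by an even amount or negates it first, so only even
indices arise from `0`. -/
lemma isConj_sr_zero_iff {n : ℕ} {y : DihedralGroup n} :
    IsConj (sr 0) y ↔ ∃ a : ZMod n, sr (2 * a) = y := by
  rw [isConj_iff]
  constructor
  · rintro ⟨b | b, rfl⟩
    · exact ⟨-b, by simp [two_mul, sub_eq_add_neg]⟩
    · exact ⟨b, by simp [two_mul]⟩
  · rintro ⟨a, rfl⟩
    exact ⟨sr a, by simp [two_mul]⟩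

lemma ncard_isConj_sr_zero {c : ℕ} (hc : 0 < c) :
    {y : DihedralGroup (2 * c) | IsConj (sr 0) y}.ncard = c := by
  have : NeZero (2 * c) := ⟨by omega⟩
  have hset : {y : DihedralGroup (2 * c) | IsConj (sr 0) y} =
      Set.range fun m : Fin c => (sr ((2 * m.val : ℕ) : ZMod (2 * c)) : DihedralGroup (2 * c)) := by
    ext y
    simp only [Set.mem_ofPred_eq, isConj_sr_zero_iff, Set.mem_range]
    constructor
    · rintro ⟨a, rfl⟩
      -- Modulo `2 * c`, the double of `a` depends only on `a` modulo `c`.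
      refine ⟨⟨a.val % c, Nat.mod_lt _ hc⟩, ?_⟩
      rw [← Nat.mul_mod_mul_left, ZMod.natCast_mod]
      simp
    · rintro ⟨m, rfl⟩
      exact ⟨m.val, by simp⟩
  rw [hset, ← Set.image_univ, Set.ncard_image_of_injective, Set.ncard_univ, Nat.card_fin]
  intro m m' h
  have h1 : ((2 * m.val : ℕ) : ZMod (2 * c)) = ((2 * m'.val : ℕ) : ZMod (2 * c)) := by
    simpa using h
  have h2 := congrArg ZMod.val h1
  rw [ZMod.val_natCast_of_lt (by omega), ZMod.val_natCast_of_lt (by omega)] at h2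
  exact Fin.ext (by omega)

end DihedralGroup

section PiConj

variable {ι : Type*} [DecidableEq ι] {H : ι → Type*} [∀ j, Group (H j)]

lemma Pi.isConj_mulSingle_iff {j : ι} {y : H j} {z : ∀ j, H j} :
    IsConj (Pi.mulSingle j y) z ↔ ∃ w, IsConj y w ∧ Pi.mulSingle j w = z := by
  constructor
  · intro h
    obtain ⟨g, rfl⟩ := isConj_iff.1 h
    refine ⟨g j * y * (g j)⁻¹, isConj_iff.2 ⟨_, rfl⟩, ?_⟩
    ext l
    rcases eq_or_ne l j with rfl | hl
    · simp
    · simp [hl]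
  · rintro ⟨w, hw, rfl⟩
    exact (MonoidHom.mulSingle H j).map_isConj hw

lemma Pi.closure_mulSingle_eq_top [Finite ι] {S : ∀ j, Set (H j)}
    (hS : ∀ j, Subgroup.closure (S j) = ⊤) {T : Set (∀ j, H j)}
    (hT : ∀ j, ∀ y ∈ S j, Pi.mulSingle j y ∈ Subgroup.closure T) : Subgroup.closure T = ⊤ := by
  rw [eq_top_iff]
  intro g _
  refine Subgroup.pi_mem_of_mulSingle_mem g fun j => ?_
  have hle : Subgroup.closure (S j) ≤ (Subgroup.closure T).comap (MonoidHom.mulSingle H j) := by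
    rw [Subgroup.closure_le]
    exact hT j
  rw [hS j] at hle
  exact hle (Subgroup.mem_top (g j))

end PiConj

/-! ### The cyclic order of the generators. -/

section Pattern

/-- The cyclic pattern of generators, of period `2 * k + 6`: the place `n` carries the generator of
index `(repetitionPattern k n).1`, which is to preserve the orientation when the second component
is `true`. -/
def repetitionPattern (k n : ℕ) : ℕ × Bool :=
  if n = 0 ∨ n = 1 ∨ n = 3 then (0, true)
  else if 4 ≤ n ∧ n < 4 + k then (n - 4, false)
  else if 4 + k ≤ n ∧ n < 4 + 2 * k then (n - 4 - k, true)
  -- This covers place `2` and the closing places `-2` and `-1`, which separate the last block from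
  -- place `0` and make `-2` differ from `0` even when `k = 1`.
  else (0, false)

lemma repetitionPattern_fst_lt {k : ℕ} (hk : 1 ≤ k) (n : ℕ) : (repetitionPattern k n).1 < k := by
  unfold repetitionPattern
  split_ifs <;> simp only <;> omega

/-- Within the block of orientation-preserving generators the indices increase strictly, and the
other adjacent repetitions allowed by the pattern are orientation-reversing. -/
lemma repetitionPattern_eq_zero {k : ℕ} (i : ZMod (2 * k + 6))
    (h : (repetitionPattern k i.val).2 = true)
    (h' : repetitionPattern k (i + 1).val = repetitionPattern k i.val) : i = 0 := by
  rw [← ZMod.val_eq_zero]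
  have hlt := ZMod.val_lt i
  have hval : (i + 1).val = i.val + 1 ∨ (i.val + 1 = 2 * k + 6 ∧ (i + 1).val = 0) := by
    have h1 : (1 : ZMod (2 * k + 6)).val = 1 := ZMod.val_one'' (by omega)
    rw [ZMod.val_add, h1]
    rcases Nat.lt_or_ge (i.val + 1) (2 * k + 6) with hi | hi
    · exact Or.inl (Nat.mod_eq_of_lt hi)
    · have : i.val + 1 = 2 * k + 6 := by omega
      exact Or.inr ⟨this, by rw [this, Nat.mod_self]⟩
  generalize i.val = n at *
  generalize (i + 1).val = m at *
  unfold repetitionPattern at h h'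
  split_ifs at h h' <;> simp at h h' <;> omega

end Pattern

/-! ### Assembly for the product of dihedral groups. -/

theorem corollary1p2 (k : ℕ) (hk : 1 ≤ k) (c : Fin k → ℕ) (hc : ∀ j, 0 < c j) :
    ∃ (Φ : Type) (M : SurfaceMap Φ),
      M.IsCompactMap ∧ M.WithoutBoundary ∧ M.WithoutFreeEdges ∧ M.Orientable ∧
      M.VertexTransitive ∧
      ∃ K : Fin k → ConjClasses M.Aut,
        Function.Injective K ∧
        {a : M.Aut | M.IsReflection a} = ⋃ j, (K j).carrier ∧
        ∀ j, (K j).carrier.ncard = c j := by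
  classical
  let D : Fin k → Type := fun j => DihedralGroup (2 * c j)
  let G : Type := ∀ j, D j
  let invol : ∀ (j : Fin k), Bool → D j := fun j b => DihedralGroup.sr (if b then 1 else 0)
  let gen : Fin k × Bool → G := fun p => Pi.mulSingle p.1 (invol p.1 p.2)
  have : ∀ j, NeZero (2 * c j) := fun j => ⟨by have := hc j; omega⟩
  have : ∀ j, Finite (D j) := fun j =>
    inferInstanceAs (Finite (DihedralGroup (2 * c j)))
  let ε : G →* ℤˣ := ∏ j, (DihedralGroup.altSign (c j)).comp (Pi.evalMonoidHom D j)
  have invol_ne : ∀ j b, invol j b ≠ 1 := fun j b h => by cases h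
  have ε_single : ∀ j (y : D j), ε (Pi.mulSingle j y) = DihedralGroup.altSign (c j) y := by
    intro j y
    simp only [ε, MonoidHom.finsetProd_apply, MonoidHom.comp_apply]
    rw [Finset.prod_eq_single j]
    · exact congrArg _ (Pi.mulSingle_eq_same j y)
    · intro l _ hl
      exact (congrArg _ (Pi.mulSingle_eq_of_ne hl y)).trans (map_one _)
    · simp
  have ε_gen : ∀ p, ε (gen p) = if p.2 then 1 else -1 := by
    rintro ⟨j, b⟩
    rw [ε_single]
    cases b
    · exact DihedralGroup.altSign_sr_zero _
    · exact DihedralGroup.altSign_sr_one _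
  have single_index : ∀ {j l : Fin k} {y : D j} {z : D l}, y ≠ 1 →
      (Pi.mulSingle j y : G) = Pi.mulSingle l z → j = l := by
    intro j l y z hy h
    by_contra hne
    have := congrFun h j
    rw [Pi.mulSingle_eq_same, Pi.mulSingle_eq_of_ne hne] at this
    exact hy this
  have gen_inj : Function.Injective gen := by
    rintro ⟨j, b⟩ ⟨l, b'⟩ h
    have hj : j = l := single_index (invol_ne j b) h
    have hb := congrArg ε h
    rw [ε_gen, ε_gen] at hb
    refine Prod.ext hj ?_
    cases b <;> cases b' <;> simp_all
  let x : ZMod (2 * k + 6) → G := fun i =>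
    gen (⟨_, repetitionPattern_fst_lt hk i.val⟩, (repetitionPattern k i.val).2)
  have x_eq : ∀ i j, x i = x j ↔ repetitionPattern k i.val = repetitionPattern k j.val := by
    intro i j
    simp only [x, gen_inj.eq_iff, Prod.ext_iff, Fin.ext_iff]
  have ε_x : ∀ i, ε (x i) = if (repetitionPattern k i.val).2 then 1 else -1 := fun i => ε_gen _
  have hx : ∀ i, x i * x i = 1 := by
    intro i
    change Pi.mulSingle _ _ * Pi.mulSingle _ _ = _
    rw [← Pi.mulSingle_mul, Pi.mulSingle_eq_one_iff]
    exact DihedralGroup.sr_mul_self _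
  have hx1 : ∀ i, x i ≠ 1 := fun i h => invol_ne _ _ (Pi.mulSingle_eq_one_iff.1 h)
  have hval : ∀ n, n < 2 * k + 6 → ((n : ℕ) : ZMod (2 * k + 6)).val = n := fun n hn =>
    ZMod.val_natCast_of_lt hn
  have gen_mem : ∀ p, gen p ∈ Set.range x := by
    rintro ⟨j, b⟩
    have hj := j.isLt
    cases b
    · refine ⟨((4 + j.val : ℕ) : ZMod (2 * k + 6)), ?_⟩
      simp only [x, hval (4 + j.val) (by omega)]
      congr 1
      simp only [Prod.ext_iff, Fin.ext_iff, repetitionPattern]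
      split_ifs <;> simp <;> omega
    · refine ⟨((4 + k + j.val : ℕ) : ZMod (2 * k + 6)), ?_⟩
      simp only [x, hval (4 + k + j.val) (by omega)]
      congr 1
      simp only [Prod.ext_iff, Fin.ext_iff, repetitionPattern]
      split_ifs <;> simp <;> omega
  have hgen : Subgroup.closure (Set.range x) = ⊤ := by
    refine Pi.closure_mulSingle_eq_top
      (fun j => DihedralGroup.closure_sr_zero_sr_one (2 * c j)) ?_
    rintro j y (rfl | rfl)
    · exact Subgroup.subset_closure (gen_mem (j, false))
    · exact Subgroup.subset_closure (gen_mem (j, true))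
  have v0 : (0 : ZMod (2 * k + 6)).val = 0 := ZMod.val_zero
  have v1 : (1 : ZMod (2 * k + 6)).val = 1 := by simpa using hval 1 (by omega)
  have v2 : (2 : ZMod (2 * k + 6)).val = 2 := by simpa using hval 2 (by omega)
  have v3 : (3 : ZMod (2 * k + 6)).val = 3 := by simpa using hval 3 (by omega)
  have v4 : (-2 : ZMod (2 * k + 6)).val = 2 * k + 4 := by
    have h : (-2 : ZMod (2 * k + 6)) = ((2 * k + 4 : ℕ) : ZMod (2 * k + 6)) := by
      have := ZMod.natCast_self (2 * k + 6)
      push_cast at this ⊢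
      linear_combination -this
    rw [h, hval _ (by omega)]
  have hr : SurfaceMap.IsRigid x ε :=
    { two_ne := fun h => by rw [h, v0] at v2; omega
      zero_even := by rw [ε_x, v0]; simp [repetitionPattern]
      one_eq := by rw [x_eq, v0, v1]; simp [repetitionPattern]
      three_eq := by rw [x_eq, v0, v3]; simp [repetitionPattern]
      neg_two_ne := by
        have h : ¬ 2 * k + 4 < 4 + 2 * k := by omega
        rw [Ne, x_eq, v0, v4]
        have h' : ¬ 2 * k + 4 < 4 + k := by omega
        simp [repetitionPattern, h, h']
      eq_zero := fun i h h' => by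
        rw [ε_x] at h
        refine repetitionPattern_eq_zero i ?_ ((x_eq _ _).1 h')
        by_contra hb
        simp [hb] at h }
  let e := SurfaceMap.cayleyAutEquiv x hx ε hgen hr
  have carrier_eq : ∀ j, (ConjClasses.mk (e (gen (j, false)))).carrier =
      e '' {z | IsConj (gen (j, false)) z} := by
    intro j
    exact e.carrier_conjClasses_mk _
  refine ⟨_, SurfaceMap.cayleyMap x hx ε hgen, ?_,
    SurfaceMap.cayleyMap_withoutBoundary x hx ε hgen hx1,
    SurfaceMap.cayleyMap_withoutFreeEdges x hx ε hgen hx1,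
    SurfaceMap.cayleyMap_orientable x hx ε hgen,
    SurfaceMap.cayleyMap_vertexTransitive x hx ε hgen,
    fun j => ConjClasses.mk (e (gen (j, false))), ?_, ?_, ?_⟩
  · exact inferInstanceAs (Finite (ZMod (2 * k + 6) × ℤˣ × G))
  · intro j l h
    have h1 := ConjClasses.mk_eq_mk_iff_isConj.1 h
    -- Conjugation in the product preserves the factor supporting a non-trivial element, so the `k`
    -- classes are distinct.
    have h2 : IsConj (gen (j, false)) (gen (l, false)) := by
      exact e.isConj_map_iff.1 h1
    obtain ⟨w, -, h3⟩ := Pi.isConj_mulSingle_iff.1 h2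
    exact (single_index (invol_ne l false) h3.symm).symm
  · ext a
    obtain ⟨z, rfl⟩ := e.surjective a
    rw [Set.mem_ofPred_eq, SurfaceMap.isReflection_cayleyAutEquiv_iff x hx ε hgen hr hx1]
    simp only [Set.mem_iUnion, carrier_eq, e.injective.mem_set_image, Set.mem_ofPred_eq]
    constructor
    · rintro ⟨i, hi, hz⟩
      rw [ε_x] at hi
      have hb : (repetitionPattern k i.val).2 = false := by
        by_contra hb
        simp [hb] at hi
      refine ⟨⟨_, repetitionPattern_fst_lt hk i.val⟩, ?_⟩
      simpa only [x, hb] using hz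
    · rintro ⟨j, hz⟩
      obtain ⟨i, hi⟩ := gen_mem (j, false)
      refine ⟨i, ?_, hi ▸ hz⟩
      rw [hi, ε_gen]
      rfl
  · intro j
    rw [carrier_eq, Set.ncard_image_of_injective _ e.injective]
    have himg : {z | IsConj (gen (j, false)) z} =
        (Pi.mulSingle j : D j → G) '' {y | IsConj (invol j false) y} := by
      ext z
      exact Pi.isConj_mulSingle_iff
    rw [himg, Set.ncard_image_of_injective _ (Pi.mulSingle_injective j)]
    exact DihedralGroup.ncard_isConj_sr_zero (hc j)
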